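/- For a graph $G$ and a graph $F$, let $\mathrm{ex}(G,F)$ be the maximum number of edges in a subgraph of $G$ that contains no copy of $F$ (induced or not). Let $P_k$ be the path on $k$ vertices, and let $G(N,p)$ be the binomial random graph on $N$ labelled vertices in which each pair of vertices is an edge independently with probability $p\in[0,1]$. Let $N=N(n)$ be positive integers with $N\ge n e^{2n}$ for all sufficiently large $n$, and let $p=p(n)\in[0,1]$. All logarithms are natural. (i) If $p\ge N^{-2/(5n)}$ for all sufficiently large $n$, then $$\Pr\left(\tfrac1{16}\,nN\le \mathrm{ex}(G(N,p),P_{n+1})\le \tfrac12\,nN\right)\longrightarrow 1\qquad(n\to\infty).$$ (ii) If $N^{-1}\le p\le N^{-2/(5n)}$ for all sufficiently large $n$, then, with $\omega=\omega(n)=\dfrac{\log N}{np}$, $$\Pr\left(\tfrac1{75}\,\frac{\omega}{\log\omega}\,pnN\le \mathrm{ex}(G(N,p),P_{n+1})\le 8\,\frac{\omega}{\log\omega}\,pnN\right)\longrightarrow 1\qquad(n\to\infty).$$ -/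

import Mathlib

open MeasureTheory ProbabilityTheory Filter Topology unitInterval SimpleGraph

/-- `ex(G, F)`: the maximum number of edges of an `F`-free spanning subgraph `H` of `G`, where
`F`-free means that `H` contains no (not necessarily induced) copy of `F`. For `G` complete
this is the extremal number `SimpleGraph.extremalNumber`. -/
noncomputable def exNumber {V W : Type*} [Fintype V] (G : SimpleGraph V) (F : SimpleGraph W) : ℕ :=
  open scoped Classical in
  Finset.sup {H : SimpleGraph V | H ≤ G ∧ F.Free H} (fun H => H.edgeFinset.card)

/-- The event that `a ≤ ex(G, P_k) ≤ b`, where `P_k` is the path on `k` vertices and `G` is a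
graph on `M` labelled vertices. -/
def exPathBetween (M k : ℕ) (a b : ℝ) : Set (SimpleGraph (Fin M)) :=
  {G | a ≤ (exNumber G (pathGraph k) : ℝ) ∧ (exNumber G (pathGraph k) : ℝ) ≤ b}

/-!
The lower bounds come from a bipartite construction: fix disjoint blocks of `k` vertices covering
half of the vertex set, and join each outside vertex to one block in which it sees every vertex,
if there is one. A path alternates within one block, so it has at most `2 k + 1` vertices. The
outside vertices succeed independently, and Chebyshev's inequality shows that a constant proportion
of them does.

The upper bound in the dense case is the Erdős–Gallai theorem. In the sparse case, a graph without
a path on `n + 1` vertices has a depth-first search forest of height less than `n`, so each edge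
joins a vertex to one of its fewer than `n` proper ancestors. There are at most `N ^ N` parent
functions of such forests, each leaving at most `n N` candidate edges, and a union bound applies.
-/

open scoped Finset List

section ErdosGallai

variable {V : Type*} {H : SimpleGraph V} {S : Finset V} {l l₁ l₂ : List V}

/-- The list `l` is the vertex sequence of a path of `H` all of whose vertices lie in `S`. -/
structure IsPathIn (H : SimpleGraph V) (S : Finset V) (l : List V) : Prop where
  isChain : l.IsChain H.Adj
  nodup : l.Nodup
  mem : ∀ x ∈ l, x ∈ S

namespace IsPathIn

theorem pathGraph_isContained (h : IsPathIn H S l) {m : ℕ} (hm : m ≤ l.length) :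
    pathGraph m ⊑ H := by
  have hc := List.isChain_iff_getElem.1 h.isChain
  refine ⟨⟨⟨fun i => l[i.1]'(i.2.trans_le hm), fun {i j} hij => ?_⟩, fun i j hij => ?_⟩⟩
  · rcases i with ⟨i, hi⟩
    rcases j with ⟨j, hj⟩
    obtain rfl | rfl : i + 1 = j ∨ j + 1 = i := pathGraph_adj.1 hij
    exacts [hc i (hj.trans_le hm), (hc j (hi.trans_le hm)).symm]
  · exact Fin.ext (h.nodup.getElem_inj_iff.1 hij)

theorem length_le_card (h : IsPathIn H S l) : l.length ≤ #S := by
  classical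
  rw [← List.toFinset_card_of_nodup h.nodup]
  exact Finset.card_le_card fun y hy => h.mem y (List.mem_toFinset.1 hy)

theorem cons (h : IsPathIn H S l) {u : V} (hu : u ∈ S) (hul : u ∉ l)
    (hadj : ∀ x ∈ l.head?, H.Adj u x) : IsPathIn H S (u :: l) :=
  ⟨List.isChain_cons.2 ⟨hadj, h.isChain⟩, List.nodup_cons.2 ⟨hul, h.nodup⟩,
    List.forall_mem_cons.2 ⟨hu, h.mem⟩⟩

theorem reverse (h : IsPathIn H S l) : IsPathIn H S l.reverse :=
  ⟨List.isChain_reverse.2 (h.isChain.imp fun _ _ => Adj.symm), List.nodup_reverse.2 h.nodup,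
    fun x hx => h.mem x (List.mem_reverse.1 hx)⟩

theorem append_comm (h : IsPathIn H S (l₁ ++ l₂))
    (hadj : ∀ x ∈ l₂.getLast?, ∀ y ∈ l₁.head?, H.Adj x y) : IsPathIn H S (l₂ ++ l₁) := by
  obtain ⟨hc₁, hc₂, -⟩ := List.isChain_append.1 h.isChain
  exact ⟨List.isChain_append.2 ⟨hc₂, hc₁, hadj⟩, List.perm_append_comm.nodup_iff.1 h.nodup,
    fun x hx => h.mem x (List.perm_append_comm.mem_iff.1 hx)⟩

theorem append_reverse (h : IsPathIn H S (l₁ ++ l₂))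
    (hadj : ∀ x ∈ l₁.getLast?, ∀ y ∈ l₂.getLast?, H.Adj x y) :
    IsPathIn H S (l₁ ++ l₂.reverse) := by
  obtain ⟨hc₁, hc₂, -⟩ := List.isChain_append.1 h.isChain
  have hperm : l₁ ++ l₂.reverse ~ l₁ ++ l₂ := l₂.reverse_perm.append_left l₁
  refine ⟨List.isChain_append.2 ⟨hc₁, ?_, ?_⟩, hperm.nodup_iff.2 h.nodup,
    fun x hx => h.mem x (hperm.mem_iff.1 hx)⟩
  · exact List.isChain_reverse.2 (hc₂.imp fun _ _ => Adj.symm)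
  · rwa [List.head?_reverse]

theorem exists_length_eq_succ_of_cycle (h : IsPathIn H S l)
    (hcycle : ∀ x ∈ l.getLast?, ∀ y ∈ l.head?, H.Adj x y)
    {x w : V} (hx : x ∈ l) (hw : w ∈ S) (hwl : w ∉ l) (hxw : H.Adj x w) :
    ∃ l', IsPathIn H S l' ∧ l'.length = l.length + 1 := by
  obtain ⟨l₁, l₂, rfl⟩ := List.append_of_mem hx
  have hrotate : IsPathIn H S (x :: l₂ ++ l₁) := by
    refine h.append_comm fun a ha b hb => hcycle a ?_ b ?_
    · rwa [List.getLast?_append_of_ne_nil _ (List.cons_ne_nil x l₂)]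
    · cases l₁ <;> simp_all
  refine ⟨w :: (x :: l₂ ++ l₁), hrotate.cons hw ?_ (by simpa using hxw.symm), ?_⟩
  · rwa [List.perm_append_comm.mem_iff]
  · rw [List.length_cons, List.perm_append_comm.length_eq]

end IsPathIn

/-- The list `l` is the vertex sequence of a path of `H` in `S`, of maximum length. -/
structure IsLongestPathIn (H : SimpleGraph V) (S : Finset V) (l : List V) : Prop
    extends IsPathIn H S l where
  length_le : ∀ l', IsPathIn H S l' → l'.length ≤ l.length

theorem exists_isLongestPathIn_cons (H : SimpleGraph V) (hS : S.Nonempty) :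
    ∃ a l, IsLongestPathIn H S (a :: l) := by
  obtain ⟨v, hv⟩ := hS
  have hsingle : IsPathIn H S [v] := ⟨.singleton v, List.nodup_singleton v, by simpa using hv⟩
  have hfinite : (List.length '' {l | IsPathIn H S l}).Finite :=
    (Set.finite_Iic #S).subset (Set.image_subset_iff.2 fun _ hl => hl.length_le_card)
  obtain ⟨l, hl, hmax⟩ := hfinite.exists_maximalFor' List.length _ ⟨_, hsingle⟩
  have hlongest : ∀ l', IsPathIn H S l' → l'.length ≤ l.length :=
    fun l' hl' => (le_total _ _).elim id (hmax hl')
  cases l with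
  | nil => simpa using hlongest _ hsingle
  | cons a l => exact ⟨a, l, hl, hlongest⟩

theorem exists_append_of_length_le_countP (P Q : V → Bool) (a : V) (l : List V)
    (hcount : (a :: l).length ≤ l.countP P + (a :: l).dropLast.countP Q) :
    ∃ l₁ x y l₂, a :: l = (l₁ ++ [x]) ++ y :: l₂ ∧ P y ∧ Q x := by
  induction l generalizing a with
  | nil => simp at hcount
  | cons b l ih =>
    by_cases hab : P b ∧ Q a
    · exact ⟨[], a, b, l, rfl, hab⟩
    · obtain ⟨l₁, x, y, l₂, heq, hPQ⟩ := ih b (by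
        rw [List.dropLast_cons_cons, List.countP_cons, List.countP_cons] at hcount
        grind)
      exact ⟨a :: l₁, x, y, l₂, by simp [heq], hPQ⟩

namespace IsLongestPathIn

theorem reverse (h : IsLongestPathIn H S l) : IsLongestPathIn H S l.reverse :=
  ⟨h.toIsPathIn.reverse, by simpa only [List.length_reverse] using h.length_le⟩

theorem mem_of_adj_head (h : IsLongestPathIn H S l) {x u : V} (hx : x ∈ l.head?) (hu : u ∈ S)
    (hxu : H.Adj x u) : u ∈ l := by
  by_contra hul
  have hcons : IsPathIn H S (u :: l) :=
    h.cons hu hul fun y hy => Option.mem_unique hx hy ▸ hxu.symm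
  exact absurd (h.length_le _ hcons) (by simp)

theorem mem_of_adj_getLast (h : IsLongestPathIn H S l) {x u : V} (hx : x ∈ l.getLast?)
    (hu : u ∈ S) (hxu : H.Adj x u) : u ∈ l :=
  List.mem_reverse.1 (h.reverse.mem_of_adj_head (by rwa [List.head?_reverse]) hu hxu)

theorem mem_of_adj_of_cycle (h : IsLongestPathIn H S l) (h' : IsPathIn H S l₁) (hl : l₁ ~ l)
    (hcycle : ∀ x ∈ l₁.getLast?, ∀ y ∈ l₁.head?, H.Adj x y) {x w : V} (hx : x ∈ l) (hw : w ∈ S)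
    (hxw : H.Adj x w) : w ∈ l := by
  by_contra hwl
  obtain ⟨l', hl', hlen⟩ := h'.exists_length_eq_succ_of_cycle hcycle (hl.mem_iff.2 hx) hw
    (mt hl.mem_iff.1 hwl) hxw
  have := h.length_le l' hl'
  have := hl.length_eq
  omega

variable [DecidableRel H.Adj]

theorem card_filter_adj_head_le {a : V} (h : IsLongestPathIn H S (a :: l)) :
    #{u ∈ S | H.Adj a u} ≤ l.countP (H.Adj a) := by
  classical
  rw [List.countP_eq_length_filter]
  refine (Finset.card_le_card fun u hu => ?_).trans (List.toFinset_card_le _)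
  obtain ⟨huS, hau⟩ := Finset.mem_filter.1 hu
  have hmem : u ∈ a :: l := h.mem_of_adj_head rfl huS hau
  have : u ∈ l := (List.mem_cons.1 hmem).resolve_left hau.ne'
  simpa using ⟨this, hau⟩

theorem card_filter_adj_getLast_le {a : V} (h : IsLongestPathIn H S (a :: l)) :
    #{u ∈ S | H.Adj ((a :: l).getLast (List.cons_ne_nil a l)) u} ≤
      (a :: l).dropLast.countP (H.Adj ((a :: l).getLast (List.cons_ne_nil a l))) := by
  classical
  rw [List.countP_eq_length_filter]
  refine (Finset.card_le_card fun u hu => ?_).trans (List.toFinset_card_le _)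
  obtain ⟨huS, hau⟩ := Finset.mem_filter.1 hu
  have hmem : u ∈ a :: l := h.mem_of_adj_getLast (List.getLast?_eq_some_getLast _) huS hau
  have := List.mem_dropLast_of_mem_of_ne_getLast hmem hau.ne'
  simpa using ⟨this, hau⟩

-- A vertex before a neighbour of the first vertex that is itself a neighbour of the last one
-- turns the path into a cycle on the same vertices, and a longest path cannot leave that cycle.
theorem mem_of_adj_of_length_le {a : V} (h : IsLongestPathIn H S (a :: l))
    (hdeg : (a :: l).length ≤ #{u ∈ S | H.Adj a u} +
      #{u ∈ S | H.Adj ((a :: l).getLast (List.cons_ne_nil a l)) u})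
    {x w : V} (hx : x ∈ a :: l) (hw : w ∈ S) (hxw : H.Adj x w) : w ∈ a :: l := by
  obtain ⟨l₁, y, z, l₂, heq, hz, hy⟩ := exists_append_of_length_le_countP _ _ a l
    (hdeg.trans (add_le_add h.card_filter_adj_head_le h.card_filter_adj_getLast_le))
  have hlast : (a :: l).getLast? = (z :: l₂).getLast? := by
    rw [heq, List.getLast?_append_of_ne_nil _ (List.cons_ne_nil z l₂)]
  have hpath : IsPathIn H S ((l₁ ++ [y]) ++ (z :: l₂).reverse) := by
    refine (heq ▸ h.toIsPathIn).append_reverse fun b hb c hc => ?_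
    rw [← hlast, List.getLast?_eq_some_getLast (List.cons_ne_nil a l)] at hc
    obtain rfl : y = b := by simpa using hb
    obtain rfl := Option.some_injective _ hc
    exact (of_decide_eq_true hy).symm
  have hhead : ((l₁ ++ [y]) ++ (z :: l₂).reverse).head? = (a :: l).head? := by
    rw [heq]
    cases l₁ <;> rfl
  refine h.mem_of_adj_of_cycle hpath (heq ▸ (List.reverse_perm _).append_left _)
    (fun b hb c hc => ?_) hx hw hxw
  obtain rfl : z = b := by
    simpa only [List.reverse_cons, ← List.append_assoc, List.getLast?_concat,
      Option.mem_some_iff] using hb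
  rw [hhead] at hc
  obtain rfl := Option.some_injective _ hc
  exact (of_decide_eq_true hz).symm

end IsLongestPathIn

section Interedges

variable [DecidableRel H.Adj]

theorem card_interedges_self_add_card_le (T : Finset V) :
    #(H.interedges T T) + #T ≤ #T * #T := by
  have hoff : H.interedges T T ⊆ T.offDiag := fun x hx => by
    obtain ⟨h₁, h₂, hadj⟩ := H.mem_interedges_iff.1 hx
    exact Finset.mem_offDiag.2 ⟨h₁, h₂, hadj.ne⟩
  have := Finset.card_le_card hoff
  rw [Finset.offDiag_card] at this
  have := Nat.le_mul_self #T
  omega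

variable [DecidableEq V]

theorem card_interedges_add_card_interedges_sdiff {T : Finset V} (hTS : T ⊆ S) (U : Finset V) :
    #(H.interedges T U) + #(H.interedges (S \ T) U) = #(H.interedges S U) := by
  rw [← Finset.card_union_of_disjoint (H.interedges_disjoint_left Finset.disjoint_sdiff U)]
  congr 1
  ext x
  simp only [Finset.mem_union, H.mem_interedges_iff, Finset.mem_sdiff]
  have := @hTS x.1
  tauto

theorem card_interedges_self_eq_of_subset {T : Finset V} (hTS : T ⊆ S) :
    #(H.interedges S S) =
      #(H.interedges T T) + 2 * #(H.interedges T (S \ T)) + #(H.interedges (S \ T) (S \ T)) := by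
  have hS := card_interedges_add_card_interedges_sdiff (H := H) hTS S
  have hT := card_interedges_add_card_interedges_sdiff (H := H) hTS T
  have hR := card_interedges_add_card_interedges_sdiff (H := H) hTS (S \ T)
  have : Std.Symm H.Adj := H.symm
  have hST : #(H.interedges S T) = #(H.interedges T S) := Rel.card_interedges_comm S T
  have hSR : #(H.interedges S (S \ T)) = #(H.interedges (S \ T) S) := Rel.card_interedges_comm _ _
  have hTR : #(H.interedges T (S \ T)) = #(H.interedges (S \ T) T) := Rel.card_interedges_comm _ _
  omega

theorem card_interedges_self_le_mul {n : ℕ}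
    (h : ∀ S : Finset V, S.Nonempty → ∃ T ⊆ S, T.Nonempty ∧
      #(H.interedges T T) + 2 * #(H.interedges T (S \ T)) ≤ n * #T) (S : Finset V) :
    #(H.interedges S S) ≤ n * #S := by
  induction S using Finset.strongInduction with
  | H S ih =>
    obtain rfl | hS := S.eq_empty_or_nonempty
    · simp [SimpleGraph.interedges_def]
    obtain ⟨T, hTS, hT, hle⟩ := h S hS
    have hrest := ih (S \ T) (Finset.sdiff_ssubset hTS hT)
    rw [card_interedges_self_eq_of_subset hTS, ← Finset.card_sdiff_add_card_eq_card hTS]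
    linarith

theorem exists_subset_card_interedges_le {n : ℕ} (hH : (pathGraph (n + 2)).Free H)
    (hS : S.Nonempty) : ∃ T ⊆ S, T.Nonempty ∧
      #(H.interedges T T) + 2 * #(H.interedges T (S \ T)) ≤ n * #T := by
  by_cases hlow : ∃ v ∈ S, 2 * #{u ∈ S | H.Adj v u} ≤ n
  · obtain ⟨v, hv, hdeg⟩ := hlow
    refine ⟨{v}, by simpa using hv, Finset.singleton_nonempty v, ?_⟩
    have hself := card_interedges_self_add_card_le (H := H) {v}
    have hcross : #(H.interedges {v} (S \ {v})) ≤ #{u ∈ S | H.Adj v u} := by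
      refine Finset.card_le_card_of_injOn Prod.snd (fun x hx => ?_) fun x hx y hy hxy => ?_
      · obtain ⟨h₁, h₂, hadj⟩ := H.mem_interedges_iff.1 hx
        rw [Finset.mem_singleton.1 h₁] at hadj
        exact Finset.mem_filter.2 ⟨Finset.sdiff_subset h₂, hadj⟩
      · have hx₁ := Finset.mem_singleton.1 (H.mem_interedges_iff.1 hx).1
        have hy₁ := Finset.mem_singleton.1 (H.mem_interedges_iff.1 hy).1
        exact Prod.ext (hx₁.trans hy₁.symm) hxy
    rw [Finset.card_singleton] at hself ⊢
    omega
  · push Not at hlow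
    obtain ⟨a, l, hl⟩ := exists_isLongestPathIn_cons H hS
    have hlen : (a :: l).length ≤ n + 1 :=
      Nat.le_of_lt_succ (not_le.1 fun h => hH (hl.pathGraph_isContained h))
    have hclosed : ∀ x ∈ a :: l, ∀ w ∈ S, H.Adj x w → w ∈ a :: l := fun x hx w hw =>
      hl.mem_of_adj_of_length_le (by
        have := hlow a (hl.mem a List.mem_cons_self)
        have := hlow _ (hl.mem _ (List.getLast_mem (List.cons_ne_nil a l)))
        omega) hx hw
    refine ⟨(a :: l).toFinset, fun x hx => hl.mem x (List.mem_toFinset.1 hx), ⟨a, by simp⟩, ?_⟩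
    have hcross : H.interedges (a :: l).toFinset (S \ (a :: l).toFinset) = ∅ := by
      refine Finset.eq_empty_of_forall_notMem fun x hx => ?_
      obtain ⟨h₁, h₂, hadj⟩ := H.mem_interedges_iff.1 hx
      obtain ⟨hS, hout⟩ := Finset.mem_sdiff.1 h₂
      exact hout (List.mem_toFinset.2 (hclosed _ (List.mem_toFinset.1 h₁) _ hS hadj))
    have hself := card_interedges_self_add_card_le (H := H) (a :: l).toFinset
    rw [List.toFinset_card_of_nodup hl.nodup] at hself ⊢
    rw [hcross, Finset.card_empty]
    nlinarith

end Interedges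

theorem two_mul_card_edgeFinset_le_of_pathGraph_free [Fintype V] [Fintype H.edgeSet] {n : ℕ}
    (hH : (pathGraph (n + 2)).Free H) : 2 * #H.edgeFinset ≤ n * Fintype.card V := by
  classical
  have hpairs : 2 * #H.edgeFinset = #(H.interedges Finset.univ Finset.univ) := by
    rw [SimpleGraph.interedges_def, Finset.univ_product_univ]
    convert H.two_mul_card_edgeFinset
  rw [hpairs, ← Finset.card_univ]
  exact card_interedges_self_le_mul (fun _ => exists_subset_card_interedges_le hH) Finset.univ

end ErdosGallai

section NormalForest

variable {V : Type*} {H : SimpleGraph V} {f : V → V} {d : V → ℕ} {a u v w : V}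

/-- A rooted spanning forest of `H`, encoded by its parent function `f` and its depth function `d`.
Roots are their own parents. -/
def IsRootedForest (H : SimpleGraph V) (f : V → V) (d : V → ℕ) : Prop :=
  ∀ v, (d v = 0 ∧ f v = v) ∨ (H.Adj v (f v) ∧ d v = d (f v) + 1)

/-- `a` is an ancestor of `v` (possibly `v` itself) in the forest with parent function `f`. -/
def IsAncestor (f : V → V) (a v : V) : Prop := ∃ j, f^[j] v = a

theorem IsAncestor.refl (f : V → V) (v : V) : IsAncestor f v v := ⟨0, rfl⟩

theorem isAncestor_apply_iff (hv : v ≠ a) : IsAncestor f a (f v) ↔ IsAncestor f a v := by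
  refine ⟨fun ⟨j, hj⟩ => ⟨j + 1, hj⟩, fun ⟨j, hj⟩ => ?_⟩
  cases j with
  | zero => exact absurd hj hv
  | succ j => exact ⟨j, hj⟩

namespace IsRootedForest

theorem depth_iterate (h : IsRootedForest H f d) (v : V) {i : ℕ} (hi : i ≤ d v) :
    d (f^[i] v) = d v - i := by
  induction i with
  | zero => rfl
  | succ i ih =>
    have := ih (by omega)
    rw [Function.iterate_succ_apply']
    rcases h (f^[i] v) with hroot | hchild <;> omega

theorem isPathIn_iterate (h : IsRootedForest H f d) {S : Finset V}
    (hS : ∀ i ≤ d v, f^[i] v ∈ S) : IsPathIn H S ((List.range (d v + 1)).map fun i => f^[i] v) where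
  isChain := by
    refine List.isChain_iff_getElem.2 fun i hi => ?_
    simp only [List.length_map, List.length_range] at hi
    simp only [List.getElem_map, List.getElem_range, Function.iterate_succ_apply']
    have := h.depth_iterate v (i := i) (by omega)
    rcases h (f^[i] v) with hroot | hchild
    exacts [by omega, hchild.1]
  nodup := by
    refine List.nodup_range.map_on fun i hi j hj hij => ?_
    rw [List.mem_range] at hi hj
    have hdi := h.depth_iterate v (i := i) (by omega)
    have hdj := h.depth_iterate v (i := j) (by omega)
    rw [hij] at hdi
    omega
  mem := List.forall_mem_map.2 fun i hi => hS i (Nat.le_of_lt_succ (List.mem_range.1 hi))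

theorem depth_lt_card [Fintype V] (h : IsRootedForest H f d) (v : V) : d v < Fintype.card V := by
  simpa using (h.isPathIn_iterate (v := v) fun _ _ => Finset.mem_univ _).length_le_card

theorem depth_lt_of_pathGraph_free (h : IsRootedForest H f d) {n : ℕ}
    (hH : (pathGraph (n + 1)).Free H) (v : V) : d v < n := by
  classical
  by_contra! hv
  have hpath := h.isPathIn_iterate (v := v) (S := (Finset.range (d v + 1)).image fun i => f^[i] v)
    fun i hi => Finset.mem_image_of_mem _ (Finset.mem_range.2 (Nat.lt_succ_of_le hi))
  exact hH (hpath.pathGraph_isContained (by simpa using hv))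

theorem exists_iterate_eq (h : IsRootedForest H f d) (hav : IsAncestor f a v) :
    ∃ j ≤ d v, f^[j] v = a := by
  obtain ⟨j, rfl⟩ := hav
  rcases le_total j (d v) with hj | hj
  · exact ⟨j, hj, rfl⟩
  have hroot : f (f^[d v] v) = f^[d v] v := by
    have := h.depth_iterate v le_rfl
    rcases h (f^[d v] v) with hroot | hchild
    exacts [hroot.2, by omega]
  obtain ⟨i, rfl⟩ := Nat.exists_eq_add_of_le' hj
  exact ⟨d v, le_rfl, by rw [Function.iterate_add_apply, Function.iterate_fixed hroot]⟩

open scoped Classical in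
theorem rehang (h : IsRootedForest H f d) (hadj : H.Adj u v) (hd : d v ≤ d u)
    (hu : ¬ IsAncestor f v u) :
    IsRootedForest H (Function.update f v u)
      fun w => if IsAncestor f v w then d w + (d u + 1 - d v) else d w := by
  intro w
  by_cases hwv : w = v
  · subst hwv
    simp only [Function.update_self, if_pos (IsAncestor.refl f w), if_neg hu]
    exact Or.inr ⟨hadj.symm, by omega⟩
  simp only [Function.update_of_ne hwv, isAncestor_apply_iff hwv]
  split_ifs with hanc
  · rcases h w with hroot | hchild
    · obtain ⟨j, hj⟩ := hanc
      exact absurd ((Function.iterate_fixed hroot.2 j).symm.trans hj) hwv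
    · exact Or.inr ⟨hchild.1, by omega⟩
  · exact h w

end IsRootedForest

-- Maximize the total depth: an edge that joins two incomparable vertices would allow the subtree
-- of its upper end to be hung below its lower end.
theorem exists_isRootedForest_forall_adj_isAncestor [Finite V] (H : SimpleGraph V) :
    ∃ f d, IsRootedForest H f d ∧ ∀ u v, H.Adj u v → IsAncestor f u v ∨ IsAncestor f v u := by
  classical
  have := Fintype.ofFinite V
  let totalDepth : (V → V) × (V → ℕ) → ℕ := fun x => ∑ w, x.2 w
  have hfinite : (totalDepth '' {x | IsRootedForest H x.1 x.2}).Finite := by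
    refine (Set.finite_Iic (Fintype.card V * Fintype.card V)).subset (Set.image_subset_iff.2 ?_)
    intro x hx
    simpa using Finset.sum_le_card_nsmul Finset.univ x.2 _ fun v _ => (hx.depth_lt_card v).le
  have hdiscrete : IsRootedForest H id 0 := fun v => Or.inl ⟨rfl, rfl⟩
  obtain ⟨⟨f, d⟩, h, hmax⟩ := hfinite.exists_maximalFor' totalDepth _ ⟨(id, 0), hdiscrete⟩
  have hanc : ∀ u v, H.Adj u v → d v ≤ d u → IsAncestor f v u := by
    intro u v hadj hd
    by_contra hu
    have hlt : totalDepth (f, d) < totalDepth (Function.update f v u,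
        fun w => if IsAncestor f v w then d w + (d u + 1 - d v) else d w) := by
      refine Finset.sum_lt_sum (fun w _ => ?_) ⟨v, Finset.mem_univ v, ?_⟩
      · dsimp only
        split_ifs <;> omega
      · simp only [if_pos (IsAncestor.refl f v)]
        omega
    exact hlt.not_ge (hmax (h.rehang hadj hd hu) hlt.le)
  refine ⟨f, d, h, fun u v hadj => ?_⟩
  exact (le_total (d u) (d v)).imp (hanc v u hadj.symm) (hanc u v hadj)

open scoped Classical in
/-- The pairs formed by a vertex and one of its `n` nearest ancestors, itself included, in the
forest with parent function `f`. -/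
noncomputable def ancestorPairs [Fintype V] (f : V → V) (n : ℕ) : Finset (Sym2 V) :=
  (Finset.univ ×ˢ Finset.range n).image fun x : V × ℕ => s(x.1, f^[x.2] x.1)

theorem card_ancestorPairs_le [Fintype V] (f : V → V) (n : ℕ) :
    #(ancestorPairs f n) ≤ n * Fintype.card V := by
  classical
  refine Finset.card_image_le.trans_eq ?_
  rw [Finset.card_product, Finset.card_univ, Finset.card_range, mul_comm]

theorem exists_edgeFinset_subset_ancestorPairs [Fintype V] [Fintype H.edgeSet] {n : ℕ}
    (hH : (pathGraph (n + 1)).Free H) : ∃ f : V → V, H.edgeFinset ⊆ ancestorPairs f n := by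
  classical
  obtain ⟨f, d, h, hanc⟩ := exists_isRootedForest_forall_adj_isAncestor H
  have hpair : ∀ u v, IsAncestor f v u → s(u, v) ∈ ancestorPairs f n := by
    intro u v huv
    obtain ⟨j, hj, rfl⟩ := h.exists_iterate_eq huv
    have hjn : j < n := hj.trans_lt (h.depth_lt_of_pathGraph_free hH u)
    exact Finset.mem_image.2 ⟨(u, j), by simpa using hjn, rfl⟩
  refine ⟨f, fun e he => ?_⟩
  induction e using Sym2.ind with
  | _ u v =>
    rcases hanc u v (by simpa using he) with huv | hvu
    exacts [Sym2.eq_swap ▸ hpair v u huv, hpair u v hvu]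

end NormalForest

section ExNumber

variable {V W : Type*} [Fintype V] {G H : SimpleGraph V} {F : SimpleGraph W}

theorem card_edgeFinset_le_exNumber [Fintype H.edgeSet] (hle : H ≤ G) (hF : F.Free H) :
    #H.edgeFinset ≤ exNumber G F := by
  classical
  refine le_of_eq_of_le (by congr!) (Finset.le_sup (f := fun H => #H.edgeFinset)
    (Finset.mem_filter.2 ⟨Finset.mem_univ H, hle, hF⟩))

open scoped Classical in
theorem exists_free_of_lt_exNumber {m : ℕ} (h : m < exNumber G F) :
    ∃ H ≤ G, F.Free H ∧ m < #H.edgeFinset := by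
  obtain ⟨H, hH, hm⟩ := Finset.lt_sup_iff.1 h
  obtain ⟨-, hle, hF⟩ := Finset.mem_filter.1 hH
  exact ⟨H, hle, hF, hm⟩

theorem two_mul_exNumber_pathGraph_le (G : SimpleGraph V) (n : ℕ) :
    2 * exNumber G (pathGraph (n + 2)) ≤ n * Fintype.card V := by
  classical
  by_contra! h
  obtain ⟨H, -, hF, hm⟩ := exists_free_of_lt_exNumber (m := n * Fintype.card V / 2) (G := G)
    (F := pathGraph (n + 2)) (by omega)
  have := two_mul_card_edgeFinset_le_of_pathGraph_free hF
  omega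

theorem exists_subset_ancestorPairs_of_lt_exNumber {n m : ℕ}
    (h : m < exNumber G (pathGraph (n + 1))) :
    ∃ f : V → V, ∃ T ∈ (ancestorPairs f n).powersetCard (m + 1), ∀ e ∈ T, e ∈ G.edgeSet := by
  classical
  obtain ⟨H, hle, hF, hm⟩ := exists_free_of_lt_exNumber h
  obtain ⟨f, hf⟩ := exists_edgeFinset_subset_ancestorPairs hF
  obtain ⟨T, hT, hTc⟩ := Finset.exists_subset_card_eq (Nat.succ_le_of_lt hm)
  exact ⟨f, T, Finset.mem_powersetCard.2 ⟨hT.trans hf, hTc⟩,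
    fun e he => edgeSet_mono hle (mem_edgeFinset.1 (hT he))⟩

end ExNumber

section BlockGraph

variable {V ι : Type*} {k m : ℕ}

theorem pathGraph_free_of_cover {H : SimpleGraph V} (col : V → ι) (C : ι → Finset V)
    (hcol : ∀ u v, H.Adj u v → col u = col v)
    (hC : ∀ u v, H.Adj u v → u ∈ C (col u) ∨ v ∈ C (col v)) (hk : ∀ i, #(C i) ≤ k)
    (hm : 2 * k + 2 ≤ m) : (pathGraph m).Free H := by
  classical
  rintro ⟨c⟩
  have hadj : ∀ i (hi : i + 1 < m), H.Adj (c ⟨i, by omega⟩) (c ⟨i + 1, hi⟩) := fun i hi =>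
    c.toHom.map_adj (pathGraph_adj.2 (Or.inl rfl))
  have hconst : ∀ i (hi : i < m), col (c ⟨i, hi⟩) = col (c ⟨0, by omega⟩) := by
    intro i
    induction i with
    | zero => exact fun _ => rfl
    | succ i ih => exact fun hi => (hcol _ _ (hadj i hi)).symm.trans (ih _)
  have hpick : ∀ j : Fin (k + 1), ∃ a : Fin m, a.1 / 2 = j.1 ∧ c a ∈ C (col (c a)) := by
    intro j
    rcases hC _ _ (hadj (2 * j.1) (by omega)) with h | h
    · exact ⟨_, by simp, h⟩
    · exact ⟨_, by simp only; omega, h⟩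
  choose a ha haC using hpick
  have hinj : Function.Injective fun j => c (a j) := fun i j hij =>
    Fin.ext (by rw [← ha i, ← ha j, c.injective hij])
  have hsub : Finset.univ.image (fun j => c (a j)) ⊆ C (col (c ⟨0, by omega⟩)) :=
    Finset.image_subset_iff.2 fun j _ => hconst (a j) (a j).2 ▸ haC j
  have := (Finset.card_le_card hsub).trans (hk _)
  rw [Finset.card_image_of_injective _ hinj, Finset.card_univ, Fintype.card_fin] at this
  omega

/-- Given disjoint blocks `b (i, ·)` of `k` vertices each, the graph in which every `v ∈ W` is
joined to all vertices of the block with index `c v`. -/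
def blockGraph (b : ι × Fin k ↪ V) (W : Finset V) (c : V → ι) : SimpleGraph V :=
  SimpleGraph.fromRel fun u v => u ∈ W ∧ ∃ j, b (c u, j) = v

variable {b : ι × Fin k ↪ V} {W : Finset V} {c : V → ι}

theorem blockGraph_le {G : SimpleGraph V} (hc : ∀ v ∈ W, ∀ j, G.Adj v (b (c v, j))) :
    blockGraph b W c ≤ G := by
  intro u v h
  obtain ⟨-, ⟨hu, j, rfl⟩ | ⟨hv, j, rfl⟩⟩ := (SimpleGraph.fromRel_adj _ _ _).1 h
  exacts [hc u hu j, (hc v hv j).symm]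

theorem pathGraph_free_blockGraph (hW : ∀ v ∈ W, v ∉ Set.range b) (hm : 2 * k + 2 ≤ m) :
    (pathGraph m).Free (blockGraph b W c) := by
  classical
  let col : V → ι := Function.extend b Prod.fst c
  let C : ι → Finset V := fun i => Finset.univ.image fun j => b (i, j)
  have hcolb : ∀ x, col (b x) = x.1 := fun x => b.injective.extend_apply _ _ x
  have hcolW : ∀ v ∈ W, col v = c v := fun v hv => Function.extend_apply' _ _ _ (hW v hv)
  have hCb : ∀ i j, b (i, j) ∈ C (col (b (i, j))) := fun i j => by
    rw [hcolb]
    exact Finset.mem_image_of_mem _ (Finset.mem_univ j)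
  refine pathGraph_free_of_cover col C (fun u v h => ?_) (fun u v h => ?_) (fun i => ?_) hm
  · obtain ⟨-, ⟨hu, j, rfl⟩ | ⟨hv, j, rfl⟩⟩ := (SimpleGraph.fromRel_adj _ _ _).1 h
    · rw [hcolW u hu, hcolb]
    · rw [hcolW v hv, hcolb]
  · obtain ⟨-, ⟨-, j, rfl⟩ | ⟨-, j, rfl⟩⟩ := (SimpleGraph.fromRel_adj _ _ _).1 h
    exacts [Or.inr (hCb _ j), Or.inl (hCb _ j)]
  · exact Finset.card_image_le.trans_eq (by simp)

theorem card_mul_le_card_edgeFinset_blockGraph [Fintype (blockGraph b W c).edgeSet]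
    (hW : ∀ v ∈ W, v ∉ Set.range b) : #W * k ≤ #(blockGraph b W c).edgeFinset := by
  have hcard : #W * k = #(W ×ˢ (Finset.univ : Finset (Fin k))) := by simp
  rw [hcard]
  refine Finset.card_le_card_of_injOn (fun x => s(x.1, b (c x.1, x.2))) ?_ ?_
  · rintro ⟨v, j⟩ hx
    have hv : v ∈ W := (Finset.mem_product.1 hx).1
    have hne : v ≠ b (c v, j) := fun h => hW v hv ⟨_, h.symm⟩
    have hadj : (blockGraph b W c).Adj v (b (c v, j)) :=
      (SimpleGraph.fromRel_adj _ _ _).2 ⟨hne, Or.inl ⟨hv, j, rfl⟩⟩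
    exact Finset.mem_coe.2 (mem_edgeFinset.2 hadj)
  · rintro ⟨v, j⟩ hx ⟨v', j'⟩ - h
    have hv : v ∈ W := (Finset.mem_product.1 hx).1
    rcases Sym2.eq_iff.1 h with ⟨rfl, h⟩ | ⟨h, -⟩
    · exact Prod.ext rfl (Prod.ext_iff.1 (b.injective h)).2
    · exact absurd ⟨_, h.symm⟩ (hW v hv)

theorem card_mul_le_exNumber_pathGraph [Fintype V] {G : SimpleGraph V}
    (hW : ∀ v ∈ W, v ∉ Set.range b) (hG : ∀ v ∈ W, ∃ i, ∀ j, G.Adj v (b (i, j)))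
    (hm : 2 * k + 2 ≤ m) : #W * k ≤ exNumber G (pathGraph m) := by
  classical
  obtain rfl | ⟨w, hw⟩ := W.eq_empty_or_nonempty
  · simp
  have : Nonempty ι := ⟨(hG w hw).choose⟩
  choose! c hc using hG
  exact (card_mul_le_card_edgeFinset_blockGraph hW).trans
    (card_edgeFinset_le_exNumber (blockGraph_le hc) (pathGraph_free_blockGraph hW hm))

end BlockGraph

section Independence

variable {Ω ι κ : Type*} [MeasurableSpace Ω] {μ : Measure Ω}

theorem probReal_iUnion_eq_of_iIndepSet [Fintype ι] {A : ι → Set Ω}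
    (hA : ∀ i, MeasurableSet (A i)) (h : iIndepSet A μ) :
    μ.real (⋃ i, A i) = 1 - ∏ i, (1 - μ.real (A i)) := by
  have := h.isProbabilityMeasure
  have hcompl : μ (⋂ i, (A i)ᶜ) = ∏ i, μ (A i)ᶜ :=
    ((iIndepSet_iff_iIndep A μ).1 h).meas_iInter fun i =>
      (MeasurableSpace.measurableSet_generateFrom (Set.mem_singleton (A i))).compl
  rw [← compl_compl (⋃ i, A i), Set.compl_iUnion,
    probReal_compl_eq_one_sub (.iInter fun i => (hA i).compl), measureReal_def, hcompl,
    ENNReal.toReal_prod]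
  exact congrArg (1 - ·) (Finset.prod_congr rfl fun i _ => probReal_compl_eq_one_sub (hA i))

theorem indepSet_iUnion_of_iIndepSet [Countable κ] {A : ι × κ → Set Ω}
    (hA : ∀ x, MeasurableSet (A x)) (h : iIndepSet A μ) {s t : ι} (hst : s ≠ t) :
    IndepSet (⋃ i, A (s, i)) (⋃ i, A (t, i)) μ := by
  have := h.isProbabilityMeasure
  have hdisj : Disjoint {x : ι × κ | x.1 = s} {x | x.1 = t} :=
    Set.disjoint_left.2 fun x hxs hxt => hst (hxs.symm.trans hxt)
  exact (h.indep_generateFrom_of_disjoint hA _ _ hdisj).indepSet_of_measurableSet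
    (.iUnion fun i => MeasurableSpace.measurableSet_generateFrom ⟨(s, i), rfl, rfl⟩)
    (.iUnion fun i => MeasurableSpace.measurableSet_generateFrom ⟨(t, i), rfl, rfl⟩)

theorem indepFun_indicator_of_indepSet {A B : Set Ω} (h : IndepSet A B μ) :
    IndepFun (A.indicator (1 : Ω → ℝ)) (B.indicator (1 : Ω → ℝ)) μ := by
  have hle : ∀ C : Set Ω, MeasurableSpace.comap (C.indicator (1 : Ω → ℝ)) inferInstance ≤
      MeasurableSpace.generateFrom {C} := fun C =>
    @Measurable.comap_le _ _ (.generateFrom {C}) _ _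
      (Measurable.indicator (m := .generateFrom {C}) (@measurable_const _ _ _ (_) 1)
        (MeasurableSpace.measurableSet_generateFrom (Set.mem_singleton C)))
  exact (IndepFun_iff_Indep _ _ _).2 (indep_of_indep_of_le_left
    (indep_of_indep_of_le_right ((IndepSet_iff_Indep A B μ).1 h) (hle B)) (hle A))

open scoped Classical in
theorem measure_card_filter_mem_lt_le [Fintype ι] [IsProbabilityMeasure μ] {A : ι → Set Ω}
    (hA : ∀ i, MeasurableSet (A i)) (h : Pairwise fun i j => IndepSet (A i) (A j) μ)
    (hpos : 0 < ∑ i, μ.real (A i)) :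
    μ {ω | (#{i | ω ∈ A i} : ℝ) < (∑ i, μ.real (A i)) / 2} ≤
      ENNReal.ofReal (4 / ∑ i, μ.real (A i)) := by
  set m := ∑ i, μ.real (A i) with hm
  let X : ι → Ω → ℝ := fun i => (A i).indicator 1
  have hX : ∀ i, MemLp (X i) 2 μ := fun i => memLp_indicator_const 2 (hA i) 1 (by simp)
  have hXint : ∀ i, μ[X i] = μ.real (A i) := fun i => integral_indicator_one (hA i)
  have hXvar : ∀ i, variance (X i) μ ≤ μ.real (A i) := fun i => by
    have hsq : X i ^ 2 = X i := by
      ext ω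
      by_cases hω : ω ∈ A i <;> simp [X, hω]
    have := variance_le_expectation_sq (hX i).aestronglyMeasurable
    rwa [hsq, hXint] at this
  have hcount : ∀ ω, (∑ i, X i) ω = #{i | ω ∈ A i} := fun ω => by
    simp [X, Set.indicator_apply]
  have hmean : μ[∑ i, X i] = m := by
    simp only [Finset.sum_apply]
    rw [integral_finsetSum _ fun i _ => (hX i).integrable one_le_two, hm]
    exact Finset.sum_congr rfl fun i _ => hXint i
  have hvar : variance (∑ i, X i) μ ≤ m := by
    rw [IndepFun.variance_sum (fun i _ => hX i)
      fun i _ j _ hij => indepFun_indicator_of_indepSet (h hij)]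
    exact Finset.sum_le_sum fun i _ => hXvar i
  have hcheb := meas_ge_le_variance_div_sq (memLp_finsetSum' Finset.univ fun i _ => hX i)
    (half_pos hpos)
  rw [hmean] at hcheb
  refine (measure_mono fun ω hω => ?_).trans (hcheb.trans (ENNReal.ofReal_le_ofReal ?_))
  · simp only [Set.mem_ofPred_eq] at hω ⊢
    rw [hcount, abs_sub_comm]
    exact le_trans (by linarith) (le_abs_self _)
  · rw [div_le_div_iff₀ (by positivity) hpos]
    nlinarith

end Independence

section BinomialRandomGraph

variable {V ι κ : Type*} {k m n : ℕ}

theorem measurableSet_mem_edgeSet (e : Sym2 V) :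
    MeasurableSet {G : SimpleGraph V | e ∈ G.edgeSet} :=
  measurable_edgeSet (measurable_set_mem e).setOf

theorem measurableSet_forall_mem_edgeSet (T : Finset (Sym2 V)) :
    MeasurableSet {G : SimpleGraph V | ∀ e ∈ T, e ∈ G.edgeSet} := by
  have : {G : SimpleGraph V | ∀ e ∈ T, e ∈ G.edgeSet} = ⋂ e ∈ T, {G | e ∈ G.edgeSet} := by
    ext G
    simp
  rw [this]
  exact Finset.measurableSet_biInter T fun e _ => measurableSet_mem_edgeSet e

theorem binomialRandom_forall_mem_edgeSet [Countable V] (p : I) {T : Finset (Sym2 V)}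
    (hT : ∀ e ∈ T, ¬ e.IsDiag) :
    binomialRandom V p {G | ∀ e ∈ T, e ∈ G.edgeSet} = (toNNReal p : ENNReal) ^ #T := by
  have hofPred : Measurable fun q : Sym2 V → Prop => {e | q e} :=
    measurable_set_iff.2 measurable_pi_apply
  have hpre : (fun q : Sym2 V → Prop => {e | q e}) ⁻¹'
      (fromEdgeSet ⁻¹' {G | ∀ e ∈ T, e ∈ G.edgeSet}) = Set.pi T fun _ => {True} := by
    ext q
    simp +contextual [hT]
  rw [binomialRandom_eq_map, Measure.map_apply measurable_fromEdgeSet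
    (measurableSet_forall_mem_edgeSet T), setBernoulli_eq_map, Measure.map_apply hofPred
    (measurable_fromEdgeSet (measurableSet_forall_mem_edgeSet T)), hpre,
    Measure.infinitePi_pi _ fun _ _ => .singleton _]
  refine Finset.prod_eq_pow_card fun e he => ?_
  simp [hT e he]

theorem binomialRandom_forall_mem_edgeSet_le [Countable V] (p : I) (T : Finset (Sym2 V)) :
    binomialRandom V p {G | ∀ e ∈ T, e ∈ G.edgeSet} ≤ (toNNReal p : ENNReal) ^ #T := by
  by_cases hT : ∀ e ∈ T, ¬ e.IsDiag
  · exact (binomialRandom_forall_mem_edgeSet p hT).le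
  · push Not at hT
    obtain ⟨e, he, hdiag⟩ := hT
    have hempty : {G : SimpleGraph V | ∀ e ∈ T, e ∈ G.edgeSet} = ∅ :=
      Set.eq_empty_of_forall_notMem fun G hG => G.not_isDiag_of_mem_edgeSet (hG e he) hdiag
    simp [hempty]

theorem iIndepSet_forall_mem_edgeSet [Countable V] (p : I) {T : κ → Finset (Sym2 V)}
    (hT : ∀ x, ∀ e ∈ T x, ¬ e.IsDiag) (hdisj : Pairwise fun x y => Disjoint (T x) (T y)) :
    iIndepSet (fun x => {G | ∀ e ∈ T x, e ∈ G.edgeSet}) (binomialRandom V p) := by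
  classical
  refine (iIndepSet_iff_meas_biInter fun x => measurableSet_forall_mem_edgeSet (T x)).2 fun s => ?_
  have hinter : ⋂ x ∈ s, {G : SimpleGraph V | ∀ e ∈ T x, e ∈ G.edgeSet} =
      {G | ∀ e ∈ s.biUnion T, e ∈ G.edgeSet} := by
    ext G
    simp only [Set.mem_iInter, Set.mem_ofPred_eq, Finset.mem_biUnion]
    grind
  rw [hinter, binomialRandom_forall_mem_edgeSet p (by simpa using fun e x _ => hT x e),
    Finset.card_biUnion fun x _ y _ hxy => hdisj hxy, ← Finset.prod_pow_eq_pow_sum]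
  exact Finset.prod_congr rfl fun x _ => (binomialRandom_forall_mem_edgeSet p (hT x)).symm

theorem binomialRandom_lt_exNumber_le [Fintype V] (p : I) (n m : ℕ) :
    binomialRandom V p {G | m < exNumber G (pathGraph (n + 1))} ≤
      (Fintype.card V : ENNReal) ^ Fintype.card V *
        ((n * Fintype.card V).choose (m + 1) * (toNNReal p : ENNReal) ^ (m + 1)) := by
  classical
  have hsub : {G : SimpleGraph V | m < exNumber G (pathGraph (n + 1))} ⊆
      ⋃ f ∈ (Finset.univ : Finset (V → V)), ⋃ T ∈ (ancestorPairs f n).powersetCard (m + 1),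
        {G | ∀ e ∈ T, e ∈ G.edgeSet} := by
    intro G hG
    obtain ⟨f, T, hT, hTG⟩ := exists_subset_ancestorPairs_of_lt_exNumber hG
    exact Set.mem_biUnion (Finset.mem_univ f) (Set.mem_biUnion hT hTG)
  have hforest : ∀ f : V → V, binomialRandom V p (⋃ T ∈ (ancestorPairs f n).powersetCard (m + 1),
      {G | ∀ e ∈ T, e ∈ G.edgeSet}) ≤
      (n * Fintype.card V).choose (m + 1) * (toNNReal p : ENNReal) ^ (m + 1) := by
    intro f
    have hT : ∀ T ∈ (ancestorPairs f n).powersetCard (m + 1),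
        binomialRandom V p {G | ∀ e ∈ T, e ∈ G.edgeSet} ≤ (toNNReal p : ENNReal) ^ (m + 1) :=
      fun T hT => (Finset.mem_powersetCard.1 hT).2 ▸ binomialRandom_forall_mem_edgeSet_le p T
    refine (measure_biUnion_finset_le _ _).trans
      ((Finset.sum_le_card_nsmul _ _ _ hT).trans ?_)
    rw [Finset.card_powersetCard, nsmul_eq_mul]
    gcongr
    exact card_ancestorPairs_le f n
  refine (measure_mono hsub).trans ((measure_biUnion_finset_le _ _).trans
    ((Finset.sum_le_card_nsmul _ _ _ fun f _ => hforest f).trans_eq ?_))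
  rw [nsmul_eq_mul, Finset.card_univ, Fintype.card_fun, Nat.cast_pow]

/-- The pairs formed by `v` and the vertices of the block `b (i, ·)`. -/
def blockPairs (b : ι × Fin k ↪ V) (v : V) (i : ι) : Finset (Sym2 V) :=
  Finset.univ.map ⟨fun j => s(v, b (i, j)), fun j j' h => by
    simpa using b.injective (Sym2.congr_right.1 h)⟩

variable {b : ι × Fin k ↪ V} {v w : V} {i j : ι}

theorem not_isDiag_of_mem_blockPairs (hv : v ∉ Set.range b) {e : Sym2 V}
    (he : e ∈ blockPairs b v i) : ¬ e.IsDiag := by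
  obtain ⟨l, -, rfl⟩ := Finset.mem_map.1 he
  exact fun h => hv ⟨_, (Sym2.mk_isDiag_iff.1 h).symm⟩

theorem disjoint_blockPairs (hv : v ∉ Set.range b) (h : (v, i) ≠ (w, j)) :
    Disjoint (blockPairs b v i) (blockPairs b w j) := by
  refine Finset.disjoint_left.2 fun e hei hej => h ?_
  obtain ⟨l, -, rfl⟩ := Finset.mem_map.1 hei
  obtain ⟨l', -, he⟩ := Finset.mem_map.1 hej
  rcases Sym2.eq_iff.1 he with ⟨rfl, hb⟩ | ⟨-, hb⟩
  · exact Prod.ext rfl (Prod.ext_iff.1 (b.injective hb)).1.symm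
  · exact absurd ⟨_, hb⟩ hv

theorem setOf_exists_forall_adj_eq (b : ι × Fin k ↪ V) (v : V) :
    {G : SimpleGraph V | ∃ i, ∀ j, G.Adj v (b (i, j))} =
      ⋃ i, {G | ∀ e ∈ blockPairs b v i, e ∈ G.edgeSet} := by
  ext G
  simp only [blockPairs, Set.mem_ofPred_eq, Set.mem_iUnion, Finset.forall_mem_map,
    Finset.mem_univ, forall_true_left]
  rfl

theorem measurableSet_exists_forall_adj [Countable ι] (b : ι × Fin k ↪ V) (v : V) :
    MeasurableSet {G : SimpleGraph V | ∃ i, ∀ j, G.Adj v (b (i, j))} :=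
  setOf_exists_forall_adj_eq b v ▸ .iUnion fun _ => measurableSet_forall_mem_edgeSet _

theorem iIndepSet_blockPairs [Countable V] (p : I) (b : ι × Fin k ↪ V) :
    iIndepSet (fun x : {v // v ∉ Set.range b} × ι =>
      {G | ∀ e ∈ blockPairs b x.1 x.2, e ∈ G.edgeSet}) (binomialRandom V p) := by
  refine iIndepSet_forall_mem_edgeSet p (fun x _ => not_isDiag_of_mem_blockPairs x.1.2)
    fun x y hxy => disjoint_blockPairs x.1.2 fun h => hxy ?_
  exact Prod.ext (Subtype.ext (Prod.ext_iff.1 h).1) (Prod.ext_iff.1 h).2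

theorem probReal_exists_forall_adj [Countable V] [Fintype ι] (p : I) (hv : v ∉ Set.range b) :
    (binomialRandom V p).real {G | ∃ i, ∀ j, G.Adj v (b (i, j))} =
      1 - (1 - (p : ℝ) ^ k) ^ Fintype.card ι := by
  have hblock : ∀ i, (binomialRandom V p).real {G | ∀ e ∈ blockPairs b v i, e ∈ G.edgeSet} =
      (p : ℝ) ^ k := fun i => by
    rw [measureReal_def, binomialRandom_forall_mem_edgeSet p fun e =>
      not_isDiag_of_mem_blockPairs hv, blockPairs, Finset.card_map, Finset.card_univ,
      Fintype.card_fin, ENNReal.toReal_pow]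
    rfl
  rw [setOf_exists_forall_adj_eq, probReal_iUnion_eq_of_iIndepSet
    (fun i => measurableSet_forall_mem_edgeSet _)
    ((iIndepSet_blockPairs p b).precomp (g := fun i => (⟨v, hv⟩, i)) (Prod.mk_right_injective _))]
  simp only [hblock, Finset.prod_const, Finset.card_univ]

theorem indepSet_exists_forall_adj [Countable V] [Countable ι] (p : I) (hv : v ∉ Set.range b)
    (hw : w ∉ Set.range b) (hvw : v ≠ w) :
    IndepSet {G | ∃ i, ∀ j, G.Adj v (b (i, j))} {G | ∃ i, ∀ j, G.Adj w (b (i, j))}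
      (binomialRandom V p) := by
  rw [setOf_exists_forall_adj_eq, setOf_exists_forall_adj_eq]
  exact indepSet_iUnion_of_iIndepSet (fun x => measurableSet_forall_mem_edgeSet _)
    (iIndepSet_blockPairs p b) (s := ⟨v, hv⟩) (t := ⟨w, hw⟩) (by simpa using hvw)

theorem binomialRandom_exNumber_lt_le [Fintype V] [Fintype ι] (p : I) (b : ι × Fin k ↪ V)
    (hm : 2 * k + 2 ≤ m) {x : ℝ} (hx : x = (1 - (1 - (p : ℝ) ^ k) ^ Fintype.card ι) *
      (Fintype.card V - Fintype.card ι * k)) (hpos : 0 < x) :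
    binomialRandom V p {G | (exNumber G (pathGraph m) : ℝ) < x / 2 * k} ≤
      ENNReal.ofReal (4 / x) := by
  classical
  let A : {v // v ∉ Set.range b} → Set (SimpleGraph V) :=
    fun v => {G | ∃ i, ∀ j, G.Adj v (b (i, j))}
  have hcard : (Fintype.card {v // v ∉ Set.range b} : ℝ) = Fintype.card V - Fintype.card ι * k := by
    have : Fintype.card {v // v ∈ Set.range b} = Fintype.card ι * k := by
      exact (Set.card_range_of_injective b.injective).trans (by simp)
    rw [Fintype.card_subtype_compl, Nat.cast_sub (Fintype.card_subtype_le _), this, Nat.cast_mul]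
  have hsum : ∑ v, (binomialRandom V p).real (A v) = x := by
    rw [Finset.sum_congr rfl fun v _ => probReal_exists_forall_adj p v.2, Finset.sum_const,
      Finset.card_univ, nsmul_eq_mul, hcard, hx, mul_comm]
  have hcheb := measure_card_filter_mem_lt_le (μ := binomialRandom V p) (A := A)
    (fun v => measurableSet_exists_forall_adj b v)
    (fun v w hvw => indepSet_exists_forall_adj p v.2 w.2 (Subtype.coe_injective.ne hvw))
    (hsum ▸ hpos)
  rw [hsum] at hcheb
  refine (measure_mono fun G hG => ?_).trans hcheb
  have hcover := card_mul_le_exNumber_pathGraph (G := G) (b := b) (k := k)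
    (W := ({v | G ∈ A v} : Finset _).map (.subtype _))
    (fun v hv => by obtain ⟨w, -, rfl⟩ := Finset.mem_map.1 hv; exact w.2)
    (fun v hv => by obtain ⟨w, hw, rfl⟩ := Finset.mem_map.1 hv; exact (Finset.mem_filter.1 hw).2) hm
  rw [Finset.card_map] at hcover
  have hcover : (#{v | G ∈ A v} : ℝ) * k ≤ exNumber G (pathGraph m) := by exact_mod_cast hcover
  have hlt : (#{v | G ∈ A v} : ℝ) < x / 2 :=
    lt_of_mul_lt_mul_right (hcover.trans_lt hG) (Nat.cast_nonneg k)
  rw [Set.mem_ofPred_eq]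
  convert hlt

end BinomialRandomGraph

section UpperTail

theorem choose_mul_pow_le (a r : ℕ) {p : ℝ} (hp : 0 ≤ p) :
    (a.choose r : ℝ) * p ^ r ≤ (Real.exp 1 * a * p / r) ^ r := by
  have hfac : (0 : ℝ) < r.factorial := by exact_mod_cast r.factorial_pos
  have hself : (0 : ℝ) < (r : ℝ) ^ r := by exact_mod_cast Nat.pow_self_pos
  have hexp : (r : ℝ) ^ r ≤ Real.exp 1 ^ r * r.factorial := by
    rw [← div_le_iff₀ hfac, ← Real.exp_nat_mul, mul_one]
    exact Real.pow_div_factorial_le_exp r r.cast_nonneg r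
  calc (a.choose r : ℝ) * p ^ r ≤ (a : ℝ) ^ r / r.factorial * p ^ r := by
        gcongr
        exact Nat.choose_le_pow_div r a
    _ = (a * p) ^ r / r.factorial := by rw [mul_pow, div_mul_eq_mul_div]
    _ ≤ Real.exp 1 ^ r * (a * p) ^ r / r ^ r := by
        rw [div_le_div_iff₀ hfac hself, mul_comm (Real.exp 1 ^ r), mul_assoc]
        gcongr
    _ = (Real.exp 1 * a * p / r) ^ r := by rw [div_pow, mul_assoc, mul_pow (Real.exp 1)]

theorem choose_mul_pow_le_exp {a r : ℕ} {p ω : ℝ} (hp : 0 ≤ p) (hω : 1 < ω)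
    (hr : 8 * (ω / Real.log ω) * p * a ≤ r) :
    (a.choose r : ℝ) * p ^ r ≤ Real.exp (-(r * Real.log ω / 2)) := by
  set y := Real.log ω with hy
  have hypos : 0 < y := Real.log_pos hω
  have hsq : ω = Real.exp (y / 2) * Real.exp (y / 2) := by
    rw [← Real.exp_add, add_halves, hy, Real.exp_log (by linarith)]
  have hconst : Real.exp 1 ≤ 8 * Real.exp (y / 2) / y := by
    rw [le_div_iff₀ hypos]
    have := Real.add_one_le_exp (y / 2)
    nlinarith [Real.exp_one_lt_d9]
  have hbase : Real.exp 1 * a * p / r ≤ Real.exp (-(y / 2)) := by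
    refine div_le_of_le_mul₀ r.cast_nonneg (Real.exp_pos _).le ?_
    calc Real.exp 1 * a * p ≤ 8 * Real.exp (y / 2) / y * a * p := by gcongr
      _ = Real.exp (-(y / 2)) * (8 * (ω / y) * p * a) := by
          rw [hsq, Real.exp_neg]
          field_simp
      _ ≤ Real.exp (-(y / 2)) * r := by gcongr
  calc (a.choose r : ℝ) * p ^ r ≤ (Real.exp 1 * a * p / r) ^ r := choose_mul_pow_le a r hp
    _ ≤ Real.exp (-(y / 2)) ^ r := by gcongr
    _ = Real.exp (-(r * y / 2)) := by
        rw [← Real.exp_nat_mul]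
        ring_nf

theorem pow_mul_choose_mul_pow_le {N n r : ℕ} {p ω : ℝ} (hN : 0 < N) (hp : 0 ≤ p) (hω : 1 < ω)
    (hlog : ω * (n * p) = Real.log N) (hr : 8 * (ω / Real.log ω) * p * n * N ≤ r) :
    (N : ℝ) ^ N * (((n * N).choose r : ℝ) * p ^ r) ≤ Real.exp (-(3 * Real.log N * N)) := by
  have hy : 0 < Real.log ω := Real.log_pos hω
  have hexponent : 4 * Real.log N * N ≤ r * Real.log ω / 2 := by
    calc 4 * Real.log N * N = 8 * (ω / Real.log ω) * p * n * N * Real.log ω / 2 := by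
          rw [← hlog]
          field_simp
          ring
      _ ≤ r * Real.log ω / 2 := by gcongr
  calc (N : ℝ) ^ N * (((n * N).choose r : ℝ) * p ^ r)
      ≤ Real.exp (N * Real.log N) * Real.exp (-(r * Real.log ω / 2)) := by
        rw [Real.exp_nat_mul, Real.exp_log (by exact_mod_cast hN)]
        gcongr
        exact choose_mul_pow_le_exp hp hω (by push_cast; linarith)
    _ ≤ Real.exp (-(3 * Real.log N * N)) := by
        rw [← Real.exp_add, Real.exp_le_exp]
        linarith

theorem binomialRandom_lt_exNumber_le_one_div {N n : ℕ} {p : I} {ω : ℝ} (hn : 1 ≤ n)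
    (hL : (n : ℝ) ≤ Real.log N) (hω : 1 < ω) (hlog : ω * (n * p) = Real.log N) :
    binomialRandom (Fin N) p {G | 8 * (ω / Real.log ω) * p * n * N <
      (exNumber G (pathGraph (n + 1)) : ℝ)} ≤ ENNReal.ofReal (1 / n) := by
  have hn' : (1 : ℝ) ≤ n := by exact_mod_cast hn
  have hnN : (n : ℝ) ≤ N := hL.trans (Real.log_le_self N.cast_nonneg)
  have hω0 := Real.log_pos hω
  have hp : (0 : ℝ) ≤ p := p.2.1
  set B := 8 * (ω / Real.log ω) * p * n * N
  have hB0 : 0 ≤ B := by positivity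
  have hunion : (N : ℝ) ^ N * (((n * N).choose (⌊B⌋₊ + 1) : ℝ) * p ^ (⌊B⌋₊ + 1)) ≤ 1 / n := by
    refine (pow_mul_choose_mul_pow_le (by exact_mod_cast hn'.trans hnN) hp hω hlog ?_).trans ?_
    · exact_mod_cast (Nat.lt_floor_add_one B).le
    · rw [Real.exp_neg, ← one_div]
      refine one_div_le_one_div_of_le (by linarith) ?_
      have := Real.add_one_le_exp (3 * Real.log N * N)
      nlinarith
  have hcoe : (toNNReal p : ENNReal) = ENNReal.ofReal p := by
    rw [ENNReal.ofReal, Real.toNNReal_of_nonneg hp]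
    rfl
  refine (measure_mono fun G hG => (Nat.floor_lt hB0).2 hG).trans
    ((binomialRandom_lt_exNumber_le p n ⌊B⌋₊).trans
      (le_trans (le_of_eq ?_) (ENNReal.ofReal_le_ofReal hunion)))
  rw [Fintype.card_fin, hcoe, ENNReal.ofReal_mul (by positivity),
    ENNReal.ofReal_mul (by positivity), ENNReal.ofReal_pow hp,
    ENNReal.ofReal_pow (by positivity), ENNReal.ofReal_natCast, ENNReal.ofReal_natCast]

end UpperTail

section LowerTail

variable {N n k m : ℕ} {p : I} {B : ℝ}

theorem binomialRandom_exNumber_lt_le_of_exp_le {q : ℝ} (hm : 2 * k + 2 ≤ m) (hN : 0 < N)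
    (hq0 : 0 < q) (hq : Real.exp (-((N / (2 * k) : ℕ) * (p : ℝ) ^ k)) ≤ 1 - q)
    (hB : B ≤ q * N / 4 * k) :
    binomialRandom (Fin N) p {G | (exNumber G (pathGraph m) : ℝ) < B} ≤
      ENNReal.ofReal (8 / (q * N)) := by
  set M := N / (2 * k) with hM
  have hMk : 2 * (M * k) ≤ N := by
    have := Nat.div_mul_le_self N (2 * k)
    rw [← hM] at this
    linarith
  let b : Fin M × Fin k ↪ Fin N :=
    finProdFinEquiv.toEmbedding.trans (Fin.castLEEmb (show M * k ≤ N by omega))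
  have hqM : q ≤ 1 - (1 - (p : ℝ) ^ k) ^ Fintype.card (Fin M) := by
    have hpow : (1 - (p : ℝ) ^ k) ^ M ≤ Real.exp (-((p : ℝ) ^ k)) ^ M :=
      pow_le_pow_left₀ (sub_nonneg.2 (pow_le_one₀ p.2.1 p.2.2)) (Real.one_sub_le_exp_neg _) M
    rw [← Real.exp_nat_mul, mul_neg] at hpow
    rw [Fintype.card_fin]
    linarith
  have houtside : (N : ℝ) / 2 ≤ (Fintype.card (Fin N) : ℝ) - Fintype.card (Fin M) * k := by
    have : (2 * (M * k) : ℝ) ≤ N := by exact_mod_cast hMk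
    simp only [Fintype.card_fin]
    linarith
  have hmean : q * (N / 2) ≤ (1 - (1 - (p : ℝ) ^ k) ^ Fintype.card (Fin M)) *
      ((Fintype.card (Fin N) : ℝ) - Fintype.card (Fin M) * k) :=
    mul_le_mul hqM houtside (by positivity) (hq0.le.trans hqM)
  have hpos : 0 < q * (N / 2) := by positivity
  refine (measure_mono fun G hG => lt_of_lt_of_le hG (hB.trans ?_)).trans
    ((binomialRandom_exNumber_lt_le p b hm rfl (hpos.trans_le hmean)).trans
      (ENNReal.ofReal_le_ofReal ?_))
  · have := mul_le_mul_of_nonneg_right hmean (Nat.cast_nonneg (α := ℝ) k)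
    linarith
  · refine (div_le_div_of_nonneg_left (by norm_num) hpos hmean).trans_eq ?_
    field_simp
    norm_num

theorem two_le_div_mul_pow (hn : 12 ≤ n) (hL : (n : ℝ) ≤ Real.log N) (hk : 0 < k)
    (hkn : 2 * k ≤ n) (hp : Real.exp (-(Real.log N / 6)) ≤ (p : ℝ) ^ k) :
    2 ≤ ((N / (2 * k) : ℕ) : ℝ) * (p : ℝ) ^ k := by
  have hn' : (12 : ℝ) ≤ n := by exact_mod_cast hn
  have hnN : (n : ℝ) ≤ N := hL.trans (Real.log_le_self N.cast_nonneg)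
  set M := N / (2 * k)
  have hNM : (N : ℝ) ≤ 2 * n * M := by
    have hM : 1 ≤ M := (Nat.one_le_div_iff (by omega)).2 (hkn.trans (by exact_mod_cast hnN))
    have hlt : N < 2 * k * (M + 1) := Nat.lt_mul_div_succ N (by omega)
    exact_mod_cast show N ≤ 2 * n * M by nlinarith
  have hexp : Real.exp (-(Real.log N / 6)) * N = Real.exp (5 / 6 * Real.log N) := by
    nth_rewrite 2 [← Real.exp_log (show (0 : ℝ) < N by linarith)]
    rw [← Real.exp_add]
    ring_nf
  have hbig : 4 * (n : ℝ) ≤ Real.exp (5 / 6 * Real.log N) := by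
    have := Real.quadratic_le_exp_of_nonneg (x := 5 / 6 * Real.log N) (by linarith)
    nlinarith
  have hscaled : n * 4 ≤ n * (2 * (M * (p : ℝ) ^ k)) := by
    calc (n : ℝ) * 4 ≤ Real.exp (-(Real.log N / 6)) * N := by linarith
      _ ≤ (p : ℝ) ^ k * (2 * n * M) :=
          mul_le_mul hp hNM (by linarith) (pow_nonneg p.2.1 k)
      _ = n * (2 * (M * (p : ℝ) ^ k)) := by ring
  linarith [le_of_mul_le_mul_left hscaled (by linarith)]

theorem binomialRandom_exNumber_lt_le_of_exp_le_pow (hn : 12 ≤ n) (hL : (n : ℝ) ≤ Real.log N)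
    (hk : 0 < k) (hkn : 2 * k + 1 ≤ n) (hp : Real.exp (-(Real.log N / 6)) ≤ (p : ℝ) ^ k)
    (hB : B ≤ N / 5 * k) :
    binomialRandom (Fin N) p {G | (exNumber G (pathGraph (n + 1)) : ℝ) < B} ≤
      ENNReal.ofReal (24 / n) := by
  have hn' : (12 : ℝ) ≤ n := by exact_mod_cast hn
  have hnN : (n : ℝ) ≤ N := hL.trans (Real.log_le_self N.cast_nonneg)
  have htwo := two_le_div_mul_pow hn hL hk (by omega) hp
  refine (binomialRandom_exNumber_lt_le_of_exp_le (k := k) (q := 4 / 5) (by omega)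
    (by exact_mod_cast (by linarith : (0 : ℝ) < N)) (by norm_num) ?_
    (hB.trans_eq (by ring))).trans (ENNReal.ofReal_le_ofReal ?_)
  · refine (Real.exp_le_exp.2 (neg_le_neg htwo)).trans ?_
    rw [Real.exp_neg, ← one_div]
    exact (one_div_le_one_div_of_le (by norm_num)
      (Real.quadratic_le_exp_of_nonneg (x := 2) (by norm_num))).trans (by norm_num)
  · rw [div_le_div_iff₀ (by linarith) (by linarith)]
    linarith

theorem binomialRandom_exNumber_lt_le_of_inv_le (hn : 12 ≤ n) (hnN : n ≤ N)
    (hp : (N : ℝ)⁻¹ ≤ p) (hB : B ≤ 2 / 25 * N) :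
    binomialRandom (Fin N) p {G | (exNumber G (pathGraph (n + 1)) : ℝ) < B} ≤
      ENNReal.ofReal (24 / n) := by
  have hn' : (12 : ℝ) ≤ n := by exact_mod_cast hn
  have hnN' : (n : ℝ) ≤ N := by exact_mod_cast hnN
  have hmean : 9 / 20 ≤ ((N / (2 * 1) : ℕ) : ℝ) * (p : ℝ) ^ 1 := by
    have hdiv : (N : ℝ) ≤ 2 * (N / (2 * 1) : ℕ) + 1 := by exact_mod_cast (by omega)
    rw [pow_one]
    refine le_trans ?_ (mul_le_mul_of_nonneg_left hp (by positivity))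
    rw [← div_eq_mul_inv, le_div_iff₀ (by linarith)]
    linarith
  refine (binomialRandom_exNumber_lt_le_of_exp_le (q := 7 / 20) (k := 1) (by omega) (by omega)
    (by norm_num) ?_ (hB.trans ?_)).trans (ENNReal.ofReal_le_ofReal ?_)
  · refine (Real.exp_le_exp.2 (neg_le_neg hmean)).trans ?_
    rw [Real.exp_neg, ← one_div]
    exact (one_div_le_one_div_of_le (by norm_num)
      (Real.quadratic_le_exp_of_nonneg (x := 9 / 20) (by norm_num))).trans (by norm_num)
  · push_cast
    linarith
  · rw [div_le_div_iff₀ (by linarith) (by linarith)]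
    linarith

theorem binomialRandom_exNumber_lt_le_of_rpow_le (hn : 12 ≤ n) (hL : (n : ℝ) ≤ Real.log N)
    (hp : (N : ℝ) ^ (-(2 / (5 * n)) : ℝ) ≤ p) :
    binomialRandom (Fin N) p {G | (exNumber G (pathGraph (n + 1)) : ℝ) < 1 / 16 * n * N} ≤
      ENNReal.ofReal (24 / n) := by
  have hn' : (12 : ℝ) ≤ n := by exact_mod_cast hn
  have hN : (0 : ℝ) < N := by linarith [hL.trans (Real.log_le_self N.cast_nonneg)]
  obtain ⟨k, hk⟩ : ∃ k, k = 5 * n / 12 := ⟨_, rfl⟩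
  have hk_le : (12 * k : ℝ) ≤ 5 * n := by exact_mod_cast show 12 * k ≤ 5 * n by omega
  have hle_k : (5 * n : ℝ) ≤ 16 * k := by exact_mod_cast show 5 * n ≤ 16 * k by omega
  refine binomialRandom_exNumber_lt_le_of_exp_le_pow (k := k) hn hL (by omega) (by omega) ?_
    (by nlinarith)
  calc Real.exp (-(Real.log N / 6))
      ≤ Real.exp (-(Real.log N * (2 * k / (5 * n)))) := by
        rw [Real.exp_le_exp, neg_le_neg_iff, div_eq_mul_inv (Real.log N)]
        refine mul_le_mul_of_nonneg_left ?_ (by linarith)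
        rw [div_le_iff₀ (by linarith)]
        linarith
    _ = ((N : ℝ) ^ (-(2 / (5 * n)) : ℝ)) ^ k := by
        rw [Real.rpow_def_of_pos hN, ← Real.exp_nat_mul]
        ring_nf
    _ ≤ (p : ℝ) ^ k := pow_le_pow_left₀ (by positivity) hp k

theorem binomialRandom_exNumber_lt_le_of_log_div_neg_log (hn : 12 ≤ n)
    (hL : (n : ℝ) ≤ Real.log N) (hp₁ : (N : ℝ)⁻¹ ≤ p)
    (hp₂ : 2 * Real.log N ≤ 5 * n * -Real.log p)
    (hB : B ≤ 1 / 75 * (Real.log N / -Real.log p) * N) :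
    binomialRandom (Fin N) p {G | (exNumber G (pathGraph (n + 1)) : ℝ) < B} ≤
      ENNReal.ofReal (24 / n) := by
  have hn' : (12 : ℝ) ≤ n := by exact_mod_cast hn
  have hnN : (n : ℝ) ≤ N := hL.trans (Real.log_le_self N.cast_nonneg)
  have hp : 0 < (p : ℝ) := (inv_pos.2 (by linarith)).trans_le hp₁
  have hlog : 0 < -Real.log p := by
    by_contra! h
    nlinarith
  set X := Real.log N / -Real.log p with hX
  have hXn : X ≤ 5 / 2 * n := by
    rw [hX, div_le_iff₀ hlog]
    linarith
  rcases lt_or_ge X 6 with hX6 | hX6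
  · exact binomialRandom_exNumber_lt_le_of_inv_le hn (by exact_mod_cast hnN) hp₁
      (hB.trans (by nlinarith))
  · have hk : 1 ≤ ⌊X / 6⌋₊ := (Nat.one_le_floor_iff _).2 (by linarith)
    have hk_le : (⌊X / 6⌋₊ : ℝ) ≤ X / 6 := Nat.floor_le (by linarith)
    have hlt_k : X / 6 < ⌊X / 6⌋₊ + 1 := Nat.lt_floor_add_one _
    have hk' : (1 : ℝ) ≤ ⌊X / 6⌋₊ := by exact_mod_cast hk
    refine binomialRandom_exNumber_lt_le_of_exp_le_pow (k := ⌊X / 6⌋₊) hn hL hk ?_ ?_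
      (hB.trans (by nlinarith))
    · exact_mod_cast (by linarith : (2 * ⌊X / 6⌋₊ + 1 : ℝ) ≤ n)
    · rw [← Real.exp_log hp, ← Real.exp_nat_mul, Real.exp_le_exp]
      have hXlog : X / 6 * -Real.log p = Real.log N / 6 := by
        rw [hX, div_mul_eq_mul_div, div_mul_cancel₀ _ hlog.ne']
      linarith [mul_le_mul_of_nonneg_right hk_le hlog.le]

end LowerTail

section Asymptotics

theorem le_log_of_mul_exp_le {n : ℕ} {x : ℝ} (hn : 1 ≤ n) (h : n * Real.exp (2 * n) ≤ x) :
    (n : ℝ) ≤ Real.log x := by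
  have hn' : (1 : ℝ) ≤ n := by exact_mod_cast hn
  have hexp : Real.exp n ≤ x := by
    have := Real.exp_le_exp.2 (by linarith : (n : ℝ) ≤ 2 * n)
    nlinarith [Real.exp_pos n]
  exact (Real.le_log_iff_exp_le ((Real.exp_pos _).trans_le hexp)).2 hexp

theorem inv_le_div_mul {a b c : ℝ} (hb : 0 < b) (hc : 0 < c) (hba : b ≤ a) :
    c⁻¹ ≤ a / (b * c) := by
  rw [inv_eq_one_div, div_le_div_iff₀ hc (by positivity)]
  nlinarith

theorem two_mul_log_le_of_le_rpow {x y t : ℝ} (hx : 0 < x) (hy : 0 < y) (ht : 0 < t)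
    (h : y ≤ x ^ (-(2 / (5 * t)) : ℝ)) : 2 * Real.log x ≤ 5 * t * -Real.log y := by
  have hlog := Real.log_le_log hy h
  rw [Real.log_rpow hx] at hlog
  calc 2 * Real.log x = 5 * t * (2 / (5 * t) * Real.log x) := by field_simp
    _ ≤ 5 * t * -Real.log y := by
        gcongr
        linarith

theorem binomialRandom_exNumber_lt_le_of_le_rpow {N n : ℕ} {p : I} {ω : ℝ} (hn : 12 ≤ n)
    (hL : (n : ℝ) ≤ Real.log N) (hω : ω = Real.log N / (n * p)) (hp₁ : (N : ℝ)⁻¹ ≤ p)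
    (hp₂ : (p : ℝ) ≤ (N : ℝ) ^ (-(2 / (5 * n)) : ℝ)) :
    binomialRandom (Fin N) p {G | (exNumber G (pathGraph (n + 1)) : ℝ) <
      1 / 75 * (ω / Real.log ω) * p * n * N} ≤ ENNReal.ofReal (24 / n) := by
  have hn' : (12 : ℝ) ≤ n := by exact_mod_cast hn
  have hN : (0 : ℝ) < N := by linarith [hL.trans (Real.log_le_self N.cast_nonneg)]
  have hp : 0 < (p : ℝ) := (inv_pos.2 hN).trans_le hp₁
  have hlog := two_mul_log_le_of_le_rpow hN hp (by linarith) hp₂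
  have hlogp : 0 < -Real.log p := by
    by_contra! h
    nlinarith
  have hlogω : -Real.log p ≤ Real.log ω := by
    rw [← Real.log_inv, hω]
    exact Real.log_le_log (inv_pos.2 hp) (inv_le_div_mul (by linarith) hp hL)
  refine binomialRandom_exNumber_lt_le_of_log_div_neg_log hn hL hp₁ hlog ?_
  calc 1 / 75 * (ω / Real.log ω) * p * n * N
      = 1 / 75 * (ω * (n * p) / Real.log ω) * N := by ring
    _ = 1 / 75 * (Real.log N / Real.log ω) * N := by
        rw [hω, div_mul_cancel₀ _ (by positivity)]
    _ ≤ 1 / 75 * (Real.log N / -Real.log p) * N := by gcongr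

theorem binomialRandom_lt_exNumber_le_of_le_rpow {N n : ℕ} {p : I} {ω : ℝ} (hn : 1 ≤ n)
    (hL : (n : ℝ) ≤ Real.log N) (hω : ω = Real.log N / (n * p)) (hp₁ : (N : ℝ)⁻¹ ≤ p)
    (hp₂ : (p : ℝ) ≤ (N : ℝ) ^ (-(2 / (5 * n)) : ℝ)) :
    binomialRandom (Fin N) p {G | 8 * (ω / Real.log ω) * p * n * N <
      (exNumber G (pathGraph (n + 1)) : ℝ)} ≤ ENNReal.ofReal (1 / n) := by
  have hn' : (1 : ℝ) ≤ n := by exact_mod_cast hn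
  have hnN : (n : ℝ) ≤ N := hL.trans (Real.log_le_self N.cast_nonneg)
  have hp : 0 < (p : ℝ) := (inv_pos.2 (by linarith)).trans_le hp₁
  have hp_lt : (p : ℝ) < 1 := by
    refine hp₂.trans_lt (Real.rpow_lt_one_of_one_lt_of_neg ?_ (neg_neg_of_pos (by positivity)))
    exact (Real.log_pos_iff N.cast_nonneg).1 (by linarith)
  refine binomialRandom_lt_exNumber_le_one_div hn hL ?_ (by rw [hω]; field_simp)
  exact hω ▸ ((one_lt_inv₀ hp).2 hp_lt).trans_le (inv_le_div_mul (by linarith) hp hL)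

theorem exNumber_pathGraph_le_half {N n : ℕ} (hn : 1 ≤ n) (G : SimpleGraph (Fin N)) :
    (exNumber G (pathGraph (n + 1)) : ℝ) ≤ 1 / 2 * n * N := by
  obtain ⟨n, rfl⟩ := Nat.exists_eq_add_of_le' hn
  have h : (2 * exNumber G (pathGraph (n + 2)) : ℝ) ≤ n * N := by
    exact_mod_cast (two_mul_exNumber_pathGraph_le G n).trans_eq (by rw [Fintype.card_fin])
  push_cast
  nlinarith [Nat.cast_nonneg (α := ℝ) N]

theorem tendsto_binomialRandom_exPathBetween {N : ℕ → ℕ} {p : ℕ → I} {a b : ℕ → ℝ} {C D : ℝ}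
    (ha : ∀ᶠ n : ℕ in atTop, binomialRandom (Fin (N n)) (p n)
      {G | (exNumber G (pathGraph (n + 1)) : ℝ) < a n} ≤ ENNReal.ofReal (C / n))
    (hb : ∀ᶠ n : ℕ in atTop, binomialRandom (Fin (N n)) (p n)
      {G | b n < (exNumber G (pathGraph (n + 1)) : ℝ)} ≤ ENNReal.ofReal (D / n)) :
    Tendsto (fun n : ℕ => binomialRandom (Fin (N n)) (p n)
      (exPathBetween (N n) (n + 1) (a n) (b n))) atTop (𝓝 1) := by
  have hlim : ∀ c : ℝ, Tendsto (fun n : ℕ => ENNReal.ofReal (c / n)) atTop (𝓝 0) := fun c => by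
    simpa using ENNReal.tendsto_ofReal (tendsto_const_div_atTop_nhds_zero_nat c)
  have hlow : Tendsto (fun n : ℕ => 1 - (ENNReal.ofReal (C / n) + ENNReal.ofReal (D / n))) atTop
      (𝓝 1) := by
    simpa using ENNReal.Tendsto.sub (tendsto_const_nhds (x := (1 : ENNReal)) (f := atTop))
      ((hlim C).add (hlim D)) (Or.inl ENNReal.one_ne_top)
  refine tendsto_of_tendsto_of_tendsto_of_le_of_le' hlow tendsto_const_nhds ?_
    (Eventually.of_forall fun n => prob_le_one)
  filter_upwards [ha, hb] with n ha hb
  have hcover : (Set.univ : Set (SimpleGraph (Fin (N n)))) ⊆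
      exPathBetween (N n) (n + 1) (a n) (b n) ∪
        ({G | (exNumber G (pathGraph (n + 1)) : ℝ) < a n} ∪
          {G | b n < (exNumber G (pathGraph (n + 1)) : ℝ)}) := fun G _ =>
    or_iff_not_imp_right.2 fun h => ⟨not_lt.1 fun hlt => h (.inl hlt),
      not_lt.1 fun hlt => h (.inr hlt)⟩
  rw [tsub_le_iff_right]
  calc (1 : ENNReal) = binomialRandom (Fin (N n)) (p n) Set.univ := measure_univ.symm
    _ ≤ _ := (measure_mono hcover).trans (measure_union_le _ _)
    _ ≤ _ := by
      gcongr
      exact (measure_union_le _ _).trans (add_le_add ha hb)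

end Asymptotics

theorem theorem1p5_general (N : ℕ → ℕ) (p : ℕ → I)
    (hN : ∀ᶠ n : ℕ in atTop, (n : ℝ) ≤ Real.log (N n)) :
    ((∀ᶠ n : ℕ in atTop, (N n : ℝ) ^ (-(2 / (5 * n)) : ℝ) ≤ p n) →
      Tendsto (fun n : ℕ => binomialRandom (Fin (N n)) (p n)
          (exPathBetween (N n) (n + 1) (1 / 16 * n * N n) (1 / 2 * n * N n)))
        atTop (𝓝 1)) ∧
    (∀ ω : ℕ → ℝ, (∀ n, ω n = Real.log (N n) / (n * p n)) →
      (∀ᶠ n : ℕ in atTop, (N n : ℝ)⁻¹ ≤ p n ∧ (p n : ℝ) ≤ (N n : ℝ) ^ (-(2 / (5 * n)) : ℝ)) →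
      Tendsto (fun n : ℕ => binomialRandom (Fin (N n)) (p n)
          (exPathBetween (N n) (n + 1)
            (1 / 75 * (ω n / Real.log (ω n)) * p n * n * N n)
            (8 * (ω n / Real.log (ω n)) * p n * n * N n)))
        atTop (𝓝 1)) := by
  refine ⟨fun hp => ?_, fun ω hω hp => ?_⟩
  · refine tendsto_binomialRandom_exPathBetween (C := 24) (D := 0) ?_ ?_
    · filter_upwards [hN, hp, eventually_ge_atTop 12] with n hN hp hn
      exact binomialRandom_exNumber_lt_le_of_rpow_le hn hN hp
    · filter_upwards [eventually_ge_atTop 1] with n hn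
      have hempty : {G : SimpleGraph (Fin (N n)) | 1 / 2 * (n : ℝ) * N n <
          (exNumber G (pathGraph (n + 1)) : ℝ)} = ∅ :=
        Set.eq_empty_of_forall_notMem fun G hG => (exNumber_pathGraph_le_half hn G).not_gt hG
      rw [hempty, measure_empty]
      exact zero_le
  · refine tendsto_binomialRandom_exPathBetween (C := 24) (D := 1) ?_ ?_
    · filter_upwards [hN, hp, eventually_ge_atTop 12] with n hN hp hn
      exact binomialRandom_exNumber_lt_le_of_le_rpow hn hN (hω n) hp.1 hp.2
    · filter_upwards [hN, hp, eventually_ge_atTop 1] with n hN hp hn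
      exact binomialRandom_lt_exNumber_le_of_le_rpow hn hN (hω n) hp.1 hp.2

theorem theorem1p5 (N : ℕ → ℕ) (p : ℕ → I)
    (hN : ∀ᶠ n : ℕ in atTop, (n : ℝ) * Real.exp (2 * n) ≤ N n) :
    ((∀ᶠ n : ℕ in atTop, (N n : ℝ) ^ (-(2 / (5 * n)) : ℝ) ≤ p n) →
      Tendsto (fun n : ℕ => binomialRandom (Fin (N n)) (p n)
          (exPathBetween (N n) (n + 1) (1 / 16 * n * N n) (1 / 2 * n * N n)))
        atTop (𝓝 1)) ∧
    (∀ ω : ℕ → ℝ, (∀ n, ω n = Real.log (N n) / (n * p n)) →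
      (∀ᶠ n : ℕ in atTop, (N n : ℝ)⁻¹ ≤ p n ∧ (p n : ℝ) ≤ (N n : ℝ) ^ (-(2 / (5 * n)) : ℝ)) →
      Tendsto (fun n : ℕ => binomialRandom (Fin (N n)) (p n)
          (exPathBetween (N n) (n + 1)
            (1 / 75 * (ω n / Real.log (ω n)) * p n * n * N n)
            (8 * (ω n / Real.log (ω n)) * p n * n * N n)))
        atTop (𝓝 1)) :=
  theorem1p5_general N p <| by
    filter_upwards [hN, eventually_ge_atTop 1] with n hN hn
    exact le_log_of_mul_exp_le hn hN
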